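/- Let $S=(-\frac{\pi}{2},\frac{\pi}{2})^2\subset\mathbb R^2$, let $\Theta\subset\mathbb R$ be open, $h_0>0$, and let $\Phi(x,y,\theta,h)$, $\theta\in\Theta$, $h\in[0,h_0)$, be a family of functions that is jointly $C^\infty$ in $(x,y,\theta,h)$ for $(x,y)\in\overline S$ (up to $\partial S$ and up to $h=0$), such that each $\Phi(\cdot,\theta,h)$ is an eigenfunction of the $h$-Robin Laplacian on $S$ with an eigenvalue $\lambda(h)$: it is not identically zero, $-\Delta\Phi(\cdot,\theta,h)=\lambda(h)\Phi(\cdot,\theta,h)$ in $S$, and $\partial_\nu\Phi(\cdot,\theta,h)+h\,\Phi(\cdot,\theta,h)=0$ on the sides of $S$, where $\nu$ is the outward unit normal. Let $z_0$ be a point of one side of $S$, not a corner, let $\partial_\tau$ be the tangential derivative along this side (so $\partial_\tau=\partial_y$ if $z_0=(-\frac{\pi}{2},y_0)$ with $|y_0|<\frac{\pi}{2}$), and let $\theta_0\in\Theta$ be such that $$\Phi(z_0,\theta_0,0)=0,\qquad \partial_\tau\Phi(z_0,\theta_0,0)=0,\qquad \partial_\tau^2\Phi(z_0,\theta_0,0)\neq0,\qquad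 \partial_\theta\Phi(z_0,\theta_0,0)\neq0 .$$ Assume also that for some $\epsilon_1,\eta_1>0$ the family is defined and jointly $C^\infty$ for $(x,y)$ in the full disc $B(z_0,\epsilon_1)\subset\mathbb R^2$ and all $\theta\in\Theta$, $h\in[0,h_0)$ with $|\theta-\theta_0|+h\le\eta_1$, and satisfies $-\Delta\Phi(\cdot,\theta,h)=\lambda(h)\Phi(\cdot,\theta,h)$ there. Then there exist $\epsilon_0\in(0,\epsilon_1)$ and $\eta_0\in(0,\eta_1)$ such that the number of nodal domains of $\Phi(\cdot,\theta,h)$ in $B(z_0,\epsilon_0)\cap S$, i.e. the number of connected components of $\{z\in B(z_0,\epsilon_0)\cap S:\Phi(z,\theta,h)\neq0\}$, is exactly $3$ for $(\theta,h)=(\theta_0,0)$ and at most $3$ for all $\theta\in\Theta$, $h\in[0,h_0)$ with $|\theta-\theta_0|+h\le\eta_0$. -/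

import Mathlib

open Set Real
open scoped ContDiff Laplacian

/-- The Euclidean plane `ℝ²`. -/
abbrev Plane : Type := EuclideanSpace ℝ (Fin 2)

/-- The open square `S = (-π/2, π/2)²`. -/
def openSquare : Set Plane := {z | ∀ k, z k ∈ Ioo (-(π / 2)) (π / 2)}

/-- The closed square, the closure of `S`. -/
def closedSquare : Set Plane := {z | ∀ k, z k ∈ Icc (-(π / 2)) (π / 2)}

/-- The unit vector of the `k`-th coordinate axis. -/
noncomputable def axisVec (k : Fin 2) : Plane := EuclideanSpace.single k (1 : ℝ)

/-- For `σ = ± 1`, the side of `S` on the line `z i = σ π / 2`, without its two end points (the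
corners). Its outward unit normal is `σ • axisVec i`. -/
def openSide (i : Fin 2) (σ : ℝ) : Set Plane :=
  {z | z i = σ * (π / 2) ∧ ∀ k, k ≠ i → z k ∈ Ioo (-(π / 2)) (π / 2)}

/-- The `h`-Robin condition `∂f/∂ν + h f = 0` on the four sides of `S`, with `ν` the outward unit
normal (one-sided derivative, taken from inside the closed square). -/
def RobinCondition (h : ℝ) (f : Plane → ℝ) : Prop :=
  ∀ (i : Fin 2) (σ : ℝ), σ = 1 ∨ σ = -1 → ∀ z ∈ openSide i σ,
    lineDerivWithin ℝ f closedSquare z (σ • axisVec i) + h * f z = 0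

/-- `f`, smooth up to the boundary of `S`, is an eigenfunction of the `h`-Robin Laplacian on `S`
with eigenvalue `ev`. -/
structure IsRobinEigenfunction (h ev : ℝ) (f : Plane → ℝ) : Prop where
  smooth : ContDiffOn ℝ ∞ f closedSquare
  ne_zero : ∃ z ∈ openSquare, f z ≠ 0
  eigen : ∀ z ∈ openSquare, -(Δ f z) = ev * f z
  robin : RobinCondition h f

/-- `Φ(·, θ, h)`, for `θ ∈ Θ` and `h ∈ [0, h₀)`, is a `C^∞` family (jointly in all variables) of
Robin eigenfunctions on `S`, where `Φ(·, θ, h)` satisfies the `h`-Robin condition and has the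
eigenvalue `ev h`. -/
structure IsSmoothRobinFamily (Θ : Set ℝ) (h₀ : ℝ) (ev : ℝ → ℝ) (Φ : Plane → ℝ → ℝ → ℝ) :
    Prop where
  smooth : ContDiffOn ℝ ∞ (fun p : Plane × ℝ × ℝ => Φ p.1 p.2.1 p.2.2)
    (closedSquare ×ˢ (Θ ×ˢ Ico 0 h₀))
  eigenfunction : ∀ θ ∈ Θ, ∀ h ∈ Ico 0 h₀, IsRobinEigenfunction h (ev h) (fun z => Φ z θ h)

/-- The nodal domains of `f` in `U`: the connected components of `{z ∈ U | f z ≠ 0}`. -/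
def nodalDomains (f : Plane → ℝ) (U : Set Plane) : Set (Set Plane) :=
  {C | ∃ z ∈ {w ∈ U | f w ≠ 0}, C = connectedComponentIn {w ∈ U | f w ≠ 0} z}

/-!
At `(θ₀, 0)` the function vanishes at `z₀`, so the equation there reads `Δ = 0`: the second
derivatives along and across the side are opposite, and after multiplying the family by a constant
the tangential one is positive. In a small half-disc every nearby function is then strictly convex
along the side and strictly concave along the inward normals.

Let `f` be such a function. Concavity and the Robin condition `∂f/∂n = h f` with `h ≥ 0` (`n` the
inward normal) show that `f` stays negative along an inward normal once it is nonpositive, hence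
stays positive when a point is moved towards the side. So the positive part of the half-disc can be
pushed along the normals close to the side, where by convexity it misses only an interval: it has at
most two components. The negative part is connected: its sections parallel to the side are
intervals, and since `f` is larger at tangential distance `ε / 2` from `z₀` than on the central
normal, every negative point can be moved along its section to distance at most `ε / 2` and from
there inwards to one fixed section. At `(θ₀, 0)` both sides of `z₀` contribute a positive component.
-/

open Filter Topology

section Components

variable {X Y ι : Type*} [TopologicalSpace X] [TopologicalSpace Y]

/-- The set of connected components of a subset `W` of a topological space, each component being
regarded as a subset of the whole space. -/
def componentsIn (W : Set X) : Set (Set X) :=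
  connectedComponentIn W '' W

theorem encard_componentsIn_iUnion_le {A : ι → Set X} (hA : ∀ k, IsPreconnected (A k)) :
    (componentsIn (⋃ k, A k)).encard ≤ ENat.card ι := by
  have hmeets : ∀ C : componentsIn (⋃ k, A k), ∃ k, ∃ z ∈ A k,
      (C : Set X) = connectedComponentIn (⋃ k, A k) z := by
    rintro ⟨_, z, hz, rfl⟩
    obtain ⟨k, hk⟩ := mem_iUnion.1 hz
    exact ⟨k, z, hk, rfl⟩
  choose index point hpoint hcomp using hmeets
  have hinj : Function.Injective index := fun C D hCD => by
    have hD : point D ∈ A (index C) := hCD ▸ hpoint D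
    refine Subtype.ext ?_
    rw [hcomp C, hcomp D]
    exact connectedComponentIn_eq
      ((hA _).subset_connectedComponentIn (hpoint C) (subset_iUnion A _) hD)
  exact ENat.card_le_card_of_injective hinj

theorem connectedComponentIn_iUnion_eq {A : ι → Set X} (hA : ∀ k, IsPreconnected (A k))
    (hopen : ∀ k, IsOpen (A k)) (hdisj : Pairwise (Function.onFun Disjoint A)) {k : ι} {z : X}
    (hz : z ∈ A k) : connectedComponentIn (⋃ k, A k) z = A k := by
  have hrest : IsOpen (⋃ l ≠ k, A l) := isOpen_biUnion fun l _ => hopen l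
  have hcover : ⋃ l, A l ⊆ A k ∪ ⋃ l ≠ k, A l := by
    refine iUnion_subset fun l => ?_
    rcases eq_or_ne l k with rfl | hl
    · exact subset_union_left
    · exact (subset_biUnion_of_mem (u := A) hl).trans subset_union_right
  refine subset_antisymm ?_ ((hA k).subset_connectedComponentIn hz (subset_iUnion A k))
  exact isPreconnected_connectedComponentIn.subset_left_of_subset_union (hopen k) hrest
    (disjoint_iUnion₂_right.2 fun l hl => hdisj hl.symm)
    ((connectedComponentIn_subset _ _).trans hcover)
    ⟨z, mem_connectedComponentIn (mem_iUnion_of_mem k hz), hz⟩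

theorem encard_componentsIn_iUnion_eq {A : ι → Set X} (hA : ∀ k, IsConnected (A k))
    (hopen : ∀ k, IsOpen (A k)) (hdisj : Pairwise (Function.onFun Disjoint A)) :
    (componentsIn (⋃ k, A k)).encard = ENat.card ι := by
  have hcomp : ∀ {k z}, z ∈ A k → connectedComponentIn (⋃ k, A k) z = A k :=
    connectedComponentIn_iUnion_eq (fun k => (hA k).isPreconnected) hopen hdisj
  have hrange : componentsIn (⋃ k, A k) = range A := by
    ext C
    constructor
    · rintro ⟨z, hz, rfl⟩
      obtain ⟨k, hk⟩ := mem_iUnion.1 hz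
      exact ⟨k, (hcomp hk).symm⟩
    · rintro ⟨k, rfl⟩
      obtain ⟨z, hz⟩ := (hA k).nonempty
      exact ⟨z, mem_iUnion_of_mem k hz, hcomp hz⟩
  have hinj : Function.Injective A := fun k l hkl => by
    by_contra hne
    obtain ⟨z, hz⟩ := (hA k).nonempty
    exact disjoint_left.1 (hdisj hne) hz (hkl ▸ hz)
  rw [hrange, ← image_univ, hinj.encard_image, encard_univ]

theorem encard_componentsIn_image (e : X ≃ₜ Y) (W : Set X) :
    (componentsIn (e '' W)).encard = (componentsIn W).encard := by
  have himage : componentsIn (e '' W) = image e '' componentsIn W := by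
    rw [componentsIn, componentsIn, image_image, image_image]
    exact image_congr fun z hz => (e.image_connectedComponentIn hz).symm
  rw [himage, (image_injective.2 e.injective).encard_image]

end Components

theorem nodalDomains_eq_componentsIn (f : Plane → ℝ) (U : Set Plane) :
    nodalDomains f U = componentsIn {z ∈ U | f z ≠ 0} := by
  ext C
  simp only [nodalDomains, componentsIn, mem_image, mem_ofPred_eq, eq_comm]

theorem eventually_eventually_forall_mem {ι X T : Type*} [TopologicalSpace X] [TopologicalSpace T]
    {l : Filter ι} {s : ι → Set X} {t : T} {x : X} {P : T × X → Prop}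
    (hs : Tendsto s l (𝓝 x).smallSets) (h : ∀ᶠ p in 𝓝 (t, x), P p) :
    ∀ᶠ k in l, ∀ᶠ q in 𝓝 t, ∀ y ∈ s k, P (q, y) := by
  rw [nhds_prod_eq] at h
  obtain ⟨Pt, hPt, Px, hPx, hP⟩ := eventually_prod_iff.1 h
  filter_upwards [hs.eventually hPx.smallSets] with k hk
  filter_upwards [hPt] with q hq y hy using hP hq (hk y hy)

theorem ordConnected_Iio_diff {α : Type*} [LinearOrder α] {K : Set α} (hK : K.OrdConnected)
    {b : α} (hb : b ∈ K) : (Iio b \ K).OrdConnected :=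
  ⟨fun _ _ _ ht _ hu => ⟨hu.2.trans_lt ht.1, fun huK => ht.2 (hK.out huK hb ⟨hu.2, ht.1.le⟩)⟩⟩

theorem ordConnected_Ioi_diff {α : Type*} [LinearOrder α] {K : Set α} (hK : K.OrdConnected)
    {b : α} (hb : b ∈ K) : (Ioi b \ K).OrdConnected :=
  ⟨fun _ hs _ _ _ hu => ⟨hs.1.trans_le hu.1, fun huK => hs.2 (hK.out hb huK ⟨hs.1.le, hu.1⟩)⟩⟩

theorem joinedIn_of_forall_uIcc_fst {W : Set (ℝ × ℝ)} {x y s : ℝ}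
    (h : ∀ t ∈ uIcc x y, (t, s) ∈ W) : JoinedIn W (x, s) (y, s) := by
  refine JoinedIn.of_segment_subset ?_
  rw [← Prod.image_mk_segment_left, segment_eq_uIcc]
  exact image_subset_iff.2 h

theorem joinedIn_of_forall_uIcc_snd {W : Set (ℝ × ℝ)} {x s t : ℝ}
    (h : ∀ u ∈ uIcc s t, (x, u) ∈ W) : JoinedIn W (x, s) (x, t) := by
  refine JoinedIn.of_segment_subset ?_
  rw [← Prod.image_mk_segment_right, segment_eq_uIcc]
  exact image_subset_iff.2 h

theorem isPreconnected_of_forall_joinedIn {X : Type*} [TopologicalSpace X] {W : Set X}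
    (h : ∀ x ∈ W, ∀ y ∈ W, JoinedIn W x y) : IsPreconnected W := by
  rcases W.eq_empty_or_nonempty with rfl | hW
  · exact isPreconnected_empty
  · exact (isPathConnected_iff.2 ⟨hW, h⟩).isConnected.isPreconnected

/-- The open Euclidean disc of radius `|ε|` about the origin, in coordinates `(x, s)`. -/
def disc (ε : ℝ) : Set (ℝ × ℝ) := {p | p.1 ^ 2 + p.2 ^ 2 < ε ^ 2}

/-- The half of `disc ε` on which the first (inward normal) coordinate is positive. -/
def halfDisc (ε : ℝ) : Set (ℝ × ℝ) := {p ∈ disc ε | 0 < p.1}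

/-- The part of the half-disc on which `G` is negative. -/
def negRegion (ε : ℝ) (G : ℝ × ℝ → ℝ) : Set (ℝ × ℝ) := {p ∈ halfDisc ε | G p < 0}

/-- The part of the half-disc that lies over the set `I` of tangential coordinates and on which `G`
is positive. -/
def posRegion (ε : ℝ) (G : ℝ × ℝ → ℝ) (I : Set ℝ) : Set (ℝ × ℝ) :=
  {p ∈ halfDisc ε | 0 < G p ∧ p.2 ∈ I}

/-- A continuous function on `disc ε` that has the shape of a saddle over the closed half-disc
`0 ≤ x`: along an inward normal it stays negative once it is nonpositive, and it is quasiconvex in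
the tangential direction. -/
structure IsHalfDiscSaddle (ε : ℝ) (G : ℝ × ℝ → ℝ) : Prop where
  continuousOn : ContinuousOn G (disc ε)
  neg_of_nonpos : ∀ {s x y : ℝ}, 0 ≤ x → x < y → (y, s) ∈ disc ε → G (x, s) ≤ 0 → G (y, s) < 0
  quasiconvexOn : ∀ x : ℝ, QuasiconvexOn ℝ {s | (x, s) ∈ disc ε} fun s => G (x, s)

section Disc

variable {ε x y s : ℝ} {p q : ℝ × ℝ}

theorem isOpen_disc (ε : ℝ) : IsOpen (disc ε) :=
  isOpen_lt (by fun_prop) (by fun_prop)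

theorem isOpen_halfDisc (ε : ℝ) : IsOpen (halfDisc ε) :=
  (isOpen_disc ε).inter (isOpen_lt continuous_const continuous_fst)

theorem mem_disc_of_abs_le (hp : p ∈ disc ε) (h₁ : |q.1| ≤ |p.1|) (h₂ : |q.2| ≤ |p.2|) :
    q ∈ disc ε :=
  (add_le_add (sq_le_sq.2 h₁) (sq_le_sq.2 h₂)).trans_lt hp

theorem mem_disc_of_abs_le_half (hε : 0 < ε) (h₁ : |p.1| ≤ ε / 2) (h₂ : |p.2| ≤ ε / 2) :
    p ∈ disc ε := by
  have h₁' : p.1 ^ 2 ≤ (ε / 2) ^ 2 := sq_le_sq.2 (h₁.trans (le_abs_self _))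
  have h₂' : p.2 ^ 2 ≤ (ε / 2) ^ 2 := sq_le_sq.2 (h₂.trans (le_abs_self _))
  change p.1 ^ 2 + p.2 ^ 2 < ε ^ 2
  nlinarith [pow_pos hε 2]

theorem mem_halfDisc_of_le (hy : (y, s) ∈ disc ε) (hx : 0 < x) (hxy : x ≤ y) :
    (x, s) ∈ halfDisc ε :=
  ⟨mem_disc_of_abs_le hy (abs_le_abs_of_nonneg hx.le hxy) le_rfl, hx⟩

end Disc

namespace IsHalfDiscSaddle

variable {ε x y s t κ b c : ℝ} {G : ℝ × ℝ → ℝ} {I : Set ℝ} {p : ℝ × ℝ}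

theorem pos_of_le (hG : IsHalfDiscSaddle ε G) (hx : 0 ≤ x) (hxy : x ≤ y) (hy : (y, s) ∈ disc ε)
    (hpos : 0 < G (y, s)) : 0 < G (x, s) := by
  by_contra! hnonpos
  rcases hxy.eq_or_lt with rfl | hlt
  · exact hnonpos.not_gt hpos
  · exact (hG.neg_of_nonpos hx hlt hy hnonpos).not_gt hpos

theorem neg_of_le (hG : IsHalfDiscSaddle ε G) (hx : 0 ≤ x) (hxy : x ≤ y) (hy : (y, s) ∈ disc ε)
    (hneg : G (x, s) < 0) : G (y, s) < 0 := by
  rcases hxy.eq_or_lt with rfl | hlt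
  · exact hneg
  · exact hG.neg_of_nonpos hx hlt hy hneg.le

theorem joinedIn_negRegion_normal (hG : IsHalfDiscSaddle ε G) (hx : (x, s) ∈ negRegion ε G)
    (hxy : x ≤ y) (hy : (y, s) ∈ disc ε) : JoinedIn (negRegion ε G) (x, s) (y, s) := by
  refine joinedIn_of_forall_uIcc_fst fun t ht => ?_
  rw [uIcc_of_le hxy] at ht
  have hx0 : 0 < x := hx.1.2
  have htmem := mem_halfDisc_of_le hy (hx0.trans_le ht.1) ht.2
  exact ⟨htmem, hG.neg_of_le hx0.le ht.1 htmem.1 hx.2⟩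

theorem joinedIn_negRegion_tangential (hG : IsHalfDiscSaddle ε G) (hs : (x, s) ∈ negRegion ε G)
    (ht : (x, t) ∈ negRegion ε G) : JoinedIn (negRegion ε G) (x, s) (x, t) := by
  refine joinedIn_of_forall_uIcc_snd fun u hu => ?_
  have hu' := ((hG.quasiconvexOn x).convex_lt 0).ordConnected.uIcc_subset
    ⟨hs.1.1, hs.2⟩ ⟨ht.1.1, ht.2⟩ hu
  exact ⟨⟨hu'.1, hs.1.2⟩, hu'.2⟩

theorem le_max_of_mem_uIcc (hG : IsHalfDiscSaddle ε G) {u : ℝ} (hs : (x, s) ∈ disc ε)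
    (ht : (x, t) ∈ disc ε) (hu : u ∈ uIcc s t) : G (x, u) ≤ max (G (x, s)) (G (x, t)) :=
  ((hG.quasiconvexOn x (max (G (x, s)) (G (x, t)))).ordConnected.uIcc_subset
    ⟨hs, le_max_left _ _⟩ ⟨ht, le_max_right _ _⟩ hu).2

theorem exists_abs_le_mem_negRegion (hG : IsHalfDiscSaddle ε G) (hc : 0 ≤ c)
    (hbar : ∀ a : ℝ, |a| = c → G (x, 0) < G (x, a)) (hs : (x, s) ∈ negRegion ε G) :
    ∃ t, |t| ≤ c ∧ (x, t) ∈ negRegion ε G := by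
  rcases le_or_gt |s| c with hsc | hcs
  · exact ⟨s, hsc, hs⟩
  obtain ⟨a, ha, has⟩ : ∃ a, |a| = c ∧ a ∈ uIcc 0 s := by
    rcases le_total 0 s with h | h
    · rw [abs_of_nonneg h] at hcs
      exact ⟨c, abs_of_nonneg hc, mem_uIcc.2 (.inl ⟨hc, hcs.le⟩)⟩
    · rw [abs_of_nonpos h] at hcs
      exact ⟨-c, by rw [abs_neg, abs_of_nonneg hc], mem_uIcc.2 (.inr ⟨by linarith, by linarith⟩)⟩
  have has_abs : |a| ≤ |s| := ha.trans_le hcs.le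
  have haxis : (x, 0) ∈ disc ε := mem_disc_of_abs_le hs.1.1 le_rfl (by simp)
  have hGa : G (x, a) ≤ G (x, s) :=
    (le_max_iff.1 (hG.le_max_of_mem_uIcc haxis hs.1.1 has)).resolve_left (hbar a ha).not_ge
  exact ⟨a, ha.le, ⟨mem_disc_of_abs_le hs.1.1 le_rfl has_abs, hs.1.2⟩, hGa.trans_lt hs.2⟩

theorem isConnected_negRegion (hG : IsHalfDiscSaddle ε G) (hκ : 0 < κ) (hκε : κ ≤ ε / 2)
    (hneg : G (κ, 0) < 0)
    (hbar : ∀ x ∈ Icc 0 κ, ∀ a : ℝ, |a| = ε / 2 → G (x, 0) < G (x, a)) :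
    IsConnected (negRegion ε G) := by
  have hε : 0 < ε := by linarith
  have hκdisc : ∀ {t : ℝ}, |t| ≤ ε / 2 → (κ, t) ∈ disc ε := fun ht =>
    mem_disc_of_abs_le_half hε ((abs_of_pos hκ).trans_le hκε) ht
  have hcentre : (κ, 0) ∈ negRegion ε G :=
    ⟨⟨hκdisc (by rw [abs_zero]; linarith), hκ⟩, hneg⟩
  refine IsPathConnected.isConnected ⟨(κ, 0), hcentre, ?_⟩
  rintro ⟨x, s⟩ hxs
  rcases le_total κ x with hκx | hxκ
  · have hx0 : (x, 0) ∈ disc ε := mem_disc_of_abs_le hxs.1.1 le_rfl (by simp)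
    have haxis := hG.joinedIn_negRegion_normal hcentre hκx hx0
    exact haxis.trans (hG.joinedIn_negRegion_tangential haxis.target_mem hxs)
  · obtain ⟨t, ht, hxt⟩ :=
      hG.exists_abs_le_mem_negRegion (by linarith) (hbar x ⟨hxs.1.2.le, hxκ⟩) hxs
    have hnormal := hG.joinedIn_negRegion_normal hxt hxκ (hκdisc ht)
    exact (hG.joinedIn_negRegion_tangential hcentre hnormal.target_mem).trans
      (hnormal.symm.trans (hG.joinedIn_negRegion_tangential hxt hxs))

theorem eventually_pos (hG : IsHalfDiscSaddle ε G) (hp : p ∈ disc ε) (hpos : 0 < G p) :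
    ∀ᶠ q in 𝓝 p, q ∈ disc ε ∧ 0 < G q := by
  have hdisc : disc ε ∈ 𝓝 p := (isOpen_disc ε).mem_nhds hp
  exact Filter.Eventually.and hdisc
    ((hG.continuousOn.continuousAt hdisc).eventually (lt_mem_nhds hpos))

theorem isPreconnected_posRegion (hG : IsHalfDiscSaddle ε G)
    (hI : (I ∩ {s | (0, s) ∈ disc ε ∧ 0 < G (0, s)}).OrdConnected) :
    IsPreconnected (posRegion ε G I) := by
  refine isPreconnected_of_forall_joinedIn ?_
  rintro ⟨x, s⟩ hxs ⟨y, t⟩ hyt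
  have hdown : ∀ {x a s}, 0 < a → a ≤ x → (x, s) ∈ posRegion ε G I → (a, s) ∈ posRegion ε G I :=
    fun ha hax h => ⟨mem_halfDisc_of_le h.1.1 ha hax,
      hG.pos_of_le ha.le hax h.1.1 h.2.1, h.2.2⟩
  have htrace : ∀ {x s}, (x, s) ∈ posRegion ε G I →
      s ∈ I ∩ {s | (0, s) ∈ disc ε ∧ 0 < G (0, s)} := fun {x s} h =>
    have hx : 0 ≤ x := h.1.2.le
    ⟨h.2.2, mem_disc_of_abs_le h.1.1 (by simp) le_rfl, hG.pos_of_le le_rfl hx h.1.1 h.2.1⟩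
  have hsegment := hI.uIcc_subset (htrace hxs) (htrace hyt)
  have hnear : ∀ᶠ a in 𝓝 (0 : ℝ), ∀ u ∈ uIcc s t, (a, u) ∈ disc ε ∧ 0 < G (a, u) :=
    isCompact_uIcc.eventually_forall_of_forall_eventually fun u hu =>
      hG.eventually_pos (hsegment hu).2.1 (hsegment hu).2.2
  obtain ⟨m, hm, hm0, hmx, hmy⟩ : ∃ m, (∀ u ∈ uIcc s t, (m, u) ∈ disc ε ∧ 0 < G (m, u)) ∧
      0 < m ∧ m ≤ x ∧ m ≤ y := by
    refine Eventually.exists (f := 𝓝[>] 0) ?_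
    filter_upwards [hnear.filter_mono nhdsWithin_le_nhds, Ioc_mem_nhdsGT hxs.1.2,
      Ioc_mem_nhdsGT hyt.1.2] with m hm hmx hmy using ⟨hm, hmx.1, hmx.2, hmy.2⟩
  have hmiddle : JoinedIn (posRegion ε G I) (m, s) (m, t) :=
    joinedIn_of_forall_uIcc_snd fun u hu => ⟨⟨(hm u hu).1, hm0⟩, (hm u hu).2, (hsegment hu).1⟩
  have hnormal : ∀ {x s}, m ≤ x → (x, s) ∈ posRegion ε G I →
      JoinedIn (posRegion ε G I) (m, s) (x, s) := fun hmx h =>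
    joinedIn_of_forall_uIcc_fst fun a ha => by
      rw [uIcc_of_le hmx] at ha
      exact hdown (hm0.trans_le ha.1) ha.2 h
  exact (hnormal hmx hxs).symm.trans (hmiddle.trans (hnormal hmy hyt))

theorem isPreconnected_posRegion_of_ordConnected_diff (hG : IsHalfDiscSaddle ε G)
    (hI : (I \ {s | (0, s) ∈ disc ε ∧ G (0, s) ≤ 0}).OrdConnected) :
    IsPreconnected (posRegion ε G I) := by
  refine hG.isPreconnected_posRegion ?_
  convert hI.inter (hG.quasiconvexOn 0).convex.ordConnected using 1
  ext s
  simp only [mem_inter_iff, Set.mem_sdiff, mem_ofPred_eq, not_and, not_le]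
  tauto

/-- The three parts of `{G ≠ 0}` when `{G > 0}` avoids the line `s = b`. -/
def regions (ε : ℝ) (G : ℝ × ℝ → ℝ) (b : ℝ) : Fin 3 → Set (ℝ × ℝ) :=
  ![negRegion ε G, posRegion ε G (Iio b), posRegion ε G (Ioi b)]

theorem iUnion_regions (hb : ∀ p ∈ halfDisc ε, 0 < G p → p.2 ≠ b) :
    ⋃ k, regions ε G b k = {p ∈ halfDisc ε | G p ≠ 0} := by
  refine subset_antisymm (iUnion_subset fun k => ?_) fun p hp => mem_iUnion.2 ?_
  · fin_cases k
    exacts [fun p hp => ⟨hp.1, hp.2.ne⟩, fun p hp => ⟨hp.1, hp.2.1.ne'⟩,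
      fun p hp => ⟨hp.1, hp.2.1.ne'⟩]
  · rcases hp.2.lt_or_gt with hneg | hpos
    · exact ⟨0, hp.1, hneg⟩
    · rcases (hb p hp.1 hpos).lt_or_gt with hleft | hright
      exacts [⟨1, hp.1, hpos, hleft⟩, ⟨2, hp.1, hpos, hright⟩]

theorem iUnion_regions_of_nonpos (hG : IsHalfDiscSaddle ε G) (hGb : G (0, b) ≤ 0) :
    ⋃ k, regions ε G b k = {p ∈ halfDisc ε | G p ≠ 0} := by
  refine iUnion_regions ?_
  rintro ⟨x, _⟩ hp hpos rfl
  exact hGb.not_gt (hG.pos_of_le le_rfl (le_of_lt hp.2) hp.1 hpos)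

theorem isPreconnected_regions (hG : IsHalfDiscSaddle ε G) (hneg : IsPreconnected (negRegion ε G))
    (hIio : (Iio b \ {s | (0, s) ∈ disc ε ∧ G (0, s) ≤ 0}).OrdConnected)
    (hIoi : (Ioi b \ {s | (0, s) ∈ disc ε ∧ G (0, s) ≤ 0}).OrdConnected) (k : Fin 3) :
    IsPreconnected (regions ε G b k) := by
  fin_cases k
  · exact hneg
  · exact hG.isPreconnected_posRegion_of_ordConnected_diff hIio
  · exact hG.isPreconnected_posRegion_of_ordConnected_diff hIoi

theorem encard_componentsIn_le_three (hG : IsHalfDiscSaddle ε G)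
    (hneg : IsPreconnected (negRegion ε G)) :
    (componentsIn {p ∈ halfDisc ε | G p ≠ 0}).encard ≤ 3 := by
  obtain ⟨b, hcover, hpre⟩ : ∃ b, ⋃ k, regions ε G b k = {p ∈ halfDisc ε | G p ≠ 0} ∧
      ∀ k, IsPreconnected (regions ε G b k) := by
    rcases {s | (0, s) ∈ disc ε ∧ G (0, s) ≤ 0}.eq_empty_or_nonempty with hempty | ⟨b, hb⟩
    · refine ⟨ε, iUnion_regions ?_, hG.isPreconnected_regions hneg ?_ ?_⟩
      · rintro ⟨x, s⟩ ⟨hdisc, -⟩ - rfl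
        exact hdisc.not_ge (le_add_of_nonneg_left (sq_nonneg x))
      · rw [hempty, sdiff_empty]
        exact ordConnected_Iio
      · rw [hempty, sdiff_empty]
        exact ordConnected_Ioi
    · have htrace := (hG.quasiconvexOn 0 0).ordConnected
      exact ⟨b, hG.iUnion_regions_of_nonpos hb.2, hG.isPreconnected_regions hneg
        (ordConnected_Iio_diff htrace hb) (ordConnected_Ioi_diff htrace hb)⟩
  simpa [hcover] using encard_componentsIn_iUnion_le hpre

theorem isOpen_regions (hG : IsHalfDiscSaddle ε G) (k : Fin 3) : IsOpen (regions ε G b k) := by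
  have hG' : ContinuousOn G (halfDisc ε) := hG.continuousOn.mono fun p hp => hp.1
  have hneg : IsOpen (negRegion ε G) := hG'.isOpen_inter_preimage (isOpen_halfDisc ε) isOpen_Iio
  have hpos : ∀ {I : Set ℝ}, IsOpen I → IsOpen (posRegion ε G I) := fun hI =>
    (hG'.prodMk continuousOn_snd).isOpen_inter_preimage (isOpen_halfDisc ε) (isOpen_Ioi.prod hI)
  fin_cases k
  exacts [hneg, hpos isOpen_Iio, hpos isOpen_Ioi]

theorem pairwise_disjoint_regions : Pairwise (Function.onFun Disjoint (regions ε G b)) := by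
  have hsign (I : Set ℝ) : Disjoint (negRegion ε G) (posRegion ε G I) :=
    disjoint_left.2 fun p hneg hpos => hneg.2.not_gt hpos.2.1
  have hside : Disjoint (posRegion ε G (Iio b)) (posRegion ε G (Ioi b)) :=
    disjoint_left.2 fun p hleft hright => (mem_Iio.1 hleft.2.2).asymm hright.2.2
  intro k l hkl
  fin_cases k <;> fin_cases l
  exacts [absurd rfl hkl, hsign _, hsign _, (hsign _).symm, absurd rfl hkl, hside, (hsign _).symm,
    hside.symm, absurd rfl hkl]

theorem nonempty_posRegion (hG : IsHalfDiscSaddle ε G) (hs : (0, s) ∈ disc ε)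
    (hpos : 0 < G (0, s)) (hsI : s ∈ I) : (posRegion ε G I).Nonempty := by
  have hline : Tendsto (fun x : ℝ => (x, s)) (𝓝[>] 0) (𝓝 (0, s)) :=
    ((Continuous.prodMk_left s).tendsto 0).mono_left nhdsWithin_le_nhds
  obtain ⟨x, ⟨hdisc, hGx⟩, hx⟩ :=
    ((hline.eventually (hG.eventually_pos hs hpos)).and eventually_mem_nhdsWithin).exists
  exact ⟨(x, s), ⟨hdisc, hx⟩, hGx, hsI⟩

theorem encard_componentsIn_eq_three (hG : IsHalfDiscSaddle ε G)
    (hneg : IsConnected (negRegion ε G)) (hb : (0, b) ∈ disc ε) (hGb : G (0, b) ≤ 0)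
    {s₁ s₂ : ℝ} (hs₁ : s₁ < b) (hs₂ : b < s₂) (hdisc₁ : (0, s₁) ∈ disc ε)
    (hdisc₂ : (0, s₂) ∈ disc ε) (hpos₁ : 0 < G (0, s₁)) (hpos₂ : 0 < G (0, s₂)) :
    (componentsIn {p ∈ halfDisc ε | G p ≠ 0}).encard = 3 := by
  have htrace := (hG.quasiconvexOn 0 0).ordConnected
  have hconn : ∀ k, IsConnected (regions ε G b k) := fun k => by
    refine ⟨?_, hG.isPreconnected_regions hneg.isPreconnected
      (ordConnected_Iio_diff htrace ⟨hb, hGb⟩) (ordConnected_Ioi_diff htrace ⟨hb, hGb⟩) k⟩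
    fin_cases k
    · exact hneg.nonempty
    · exact hG.nonempty_posRegion hdisc₁ hpos₁ hs₁
    · exact hG.nonempty_posRegion hdisc₂ hpos₂ hs₂
  rw [← hG.iUnion_regions_of_nonpos hGb,
    encard_componentsIn_iUnion_eq hconn hG.isOpen_regions pairwise_disjoint_regions,
    ENat.card_eq_coe_fintype_card, Fintype.card_fin]
  rfl

theorem eventually_isConnected_negRegion {T : Type*} [TopologicalSpace T] {q₀ : T}
    {G : T → ℝ × ℝ → ℝ} (hε : 0 < ε) (hG : ∀ᶠ q in 𝓝 q₀, IsHalfDiscSaddle ε (G q))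
    (hcont : ContinuousOn (Function.uncurry G) (univ ×ˢ disc ε)) (hzero : G q₀ (0, 0) ≤ 0)
    (hbar : ∀ a : ℝ, |a| = ε / 2 → G q₀ (0, 0) < G q₀ (0, a)) :
    ∀ᶠ q in 𝓝 q₀, IsConnected (negRegion ε (G q)) := by
  have habs_zero : |(0 : ℝ)| ≤ ε / 2 := by rw [abs_zero]; positivity
  have hat : ∀ p ∈ disc ε, ContinuousAt (Function.uncurry G) (q₀, p) := fun p hp =>
    hcont.continuousAt ((isOpen_univ.prod (isOpen_disc ε)).mem_nhds ⟨mem_univ _, hp⟩)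
  have hslice : ∀ s : ℝ, |s| ≤ ε / 2 →
      ContinuousAt (fun r : T × ℝ => G r.1 (r.2, s)) (q₀, 0) := fun s hs =>
    ContinuousAt.comp (g := Function.uncurry G) (f := fun r : T × ℝ => (r.1, (r.2, s)))
      (x := (q₀, (0 : ℝ)))
      (hat (0, s) (mem_disc_of_abs_le_half hε habs_zero hs)) (by fun_prop)
  have hbar_at : ∀ a : ℝ, |a| = ε / 2 →
      ∀ᶠ r in 𝓝 (q₀, (0 : ℝ)), G r.1 (r.2, 0) < G r.1 (r.2, a) := fun a ha =>
    (hslice 0 habs_zero).eventually_lt (hslice a ha.le) (hbar a ha)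
  have hbar_near : ∀ᶠ r in 𝓝 (q₀, (0 : ℝ)),
      ∀ a : ℝ, |a| = ε / 2 → G r.1 (r.2, 0) < G r.1 (r.2, a) := by
    filter_upwards [hbar_at (ε / 2) (abs_of_pos (half_pos hε)),
      hbar_at (-(ε / 2)) (by rw [abs_neg, abs_of_pos (half_pos hε)])] with r hplus hminus a ha
    rcases (abs_eq (half_pos hε).le).1 ha with rfl | rfl
    exacts [hplus, hminus]
  have hbar_Icc : ∀ᶠ κ in 𝓝 (0 : ℝ), ∀ᶠ q in 𝓝 q₀, ∀ x ∈ Icc 0 κ,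
      ∀ a : ℝ, |a| = ε / 2 → G q (x, 0) < G q (x, a) :=
    eventually_eventually_forall_mem (tendsto_const_nhds.Icc tendsto_id) hbar_near
  obtain ⟨κ, hbarκ, hκ, hκε⟩ :=
    ((hbar_Icc.filter_mono nhdsWithin_le_nhds).and (Ioc_mem_nhdsGT (half_pos hε))).exists
  have hκdisc : (κ, 0) ∈ disc ε :=
    mem_disc_of_abs_le_half hε ((abs_of_pos hκ).trans_le hκε) habs_zero
  have hκneg : G q₀ (κ, 0) < 0 := hG.self_of_nhds.neg_of_nonpos le_rfl hκ hκdisc hzero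
  have hκneg_near : ∀ᶠ q in 𝓝 q₀, G q (κ, 0) < 0 :=
    (ContinuousAt.comp (g := Function.uncurry G) (f := fun q : T => (q, (κ, (0 : ℝ))))
      (hat _ hκdisc) (by fun_prop)).eventually (gt_mem_nhds hκneg)
  filter_upwards [hG, hκneg_near, hbarκ] with q hGq hq hbarq
  exact hGq.isConnected_negRegion hκ hκε hq hbarq

end IsHalfDiscSaddle

section RealConvexity

variable {D : Set ℝ} {g : ℝ → ℝ}

theorem neg_of_strictConcaveOn_of_robin (hg : StrictConcaveOn ℝ D g) {h : ℝ} (hh : 0 ≤ h)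
    (hrobin : HasDerivAt g (h * g 0) 0) (h0 : 0 ∈ D) {x y : ℝ} (hy : y ∈ D) (hx : 0 ≤ x)
    (hxy : x < y) (hgx : g x ≤ 0) : g y < 0 := by
  have hy0 : 0 < y := hx.trans_lt hxy
  rcases le_or_gt (g 0) 0 with hg0 | hg0
  · have hslope := hg.slope_lt_of_hasDerivAt h0 hy hy0 hrobin
    rw [slope_def_field, sub_zero, div_lt_iff₀ hy0] at hslope
    linarith [mul_nonpos_of_nonpos_of_nonneg (mul_nonpos_of_nonneg_of_nonpos hh hg0) hy0.le]
  · have hx0 : 0 < x := hx.lt_of_ne fun h => hgx.not_gt (h ▸ hg0)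
    by_contra! hgy
    have hchord := hg.lt_on_openSegment h0 hy hy0.ne
      ((openSegment_eq_Ioo hy0).symm ▸ mem_Ioo.2 ⟨hx0, hxy⟩)
    exact ((le_min hg0.le hgy).trans_lt hchord).not_ge hgx

theorem pos_of_strictConvexOn_of_hasDerivAt_zero (hg : StrictConvexOn ℝ D g) (h0 : 0 ∈ D)
    (hg0 : g 0 = 0) (hd : HasDerivAt g 0 0) {s : ℝ} (hs : s ∈ D) (hs0 : s ≠ 0) : 0 < g s := by
  rcases hs0.lt_or_gt with h | h
  · have hslope := hg.slope_lt_of_hasDerivAt hs h0 h hd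
    rw [slope_def_field, div_lt_iff₀ (sub_pos.2 h)] at hslope
    linarith
  · have hslope := hg.lt_slope_of_hasDerivAt h0 hs h hd
    rw [slope_def_field, lt_div_iff₀ (sub_pos.2 h)] at hslope
    linarith

end RealConvexity

section Lines

variable {E : Type*} [NormedAddCommGroup E] [NormedSpace ℝ E] {f : E → ℝ} {U : Set E} {z w v : E}

theorem hasDerivAt_line (w v : E) (t : ℝ) : HasDerivAt (fun t : ℝ => w + t • v) v t := by
  simpa using ((hasDerivAt_id t).smul_const v).const_add w

theorem hasDerivAt_comp_line {t : ℝ} (hf : DifferentiableAt ℝ f (w + t • v)) :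
    HasDerivAt (fun t : ℝ => f (w + t • v)) (fderiv ℝ f (w + t • v) v) t :=
  hf.hasFDerivAt.comp_hasDerivAt t (hasDerivAt_line w v t)

theorem deriv_deriv_comp_line {t : ℝ} (hf : ContDiffAt ℝ 2 f (w + t • v)) :
    deriv (deriv fun t : ℝ => f (w + t • v)) t = fderiv ℝ (fderiv ℝ f) (w + t • v) v v := by
  have hnear : ∀ᶠ u in 𝓝 t, ContDiffAt ℝ 2 f (w + u • v) :=
    (hasDerivAt_line w v t).continuousAt.eventually (hf.eventually (by simp))
  have hfirst : deriv (fun t : ℝ => f (w + t • v)) =ᶠ[𝓝 t]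
      fun t => fderiv ℝ f (w + t • v) v := by
    filter_upwards [hnear] with u hu
    exact (hasDerivAt_comp_line (hu.differentiableAt (by norm_num))).deriv
  have hgrad : DifferentiableAt ℝ (fderiv ℝ f) (w + t • v) :=
    (hf.fderiv_right (m := 1) (by norm_num)).differentiableAt (by norm_num)
  have hsecond : HasDerivAt (fun t : ℝ => fderiv ℝ f (w + t • v))
      (fderiv ℝ (fderiv ℝ f) (w + t • v) v) t :=
    hgrad.hasFDerivAt.comp_hasDerivAt t (hasDerivAt_line w v t)
  rw [hfirst.deriv_eq]
  simpa only [map_zero, add_zero] using (hsecond.clm_apply (hasDerivAt_const t v)).deriv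

theorem iteratedDeriv_two_comp_line (hf : ContDiffAt ℝ 2 f z) :
    iteratedDeriv 2 (fun t : ℝ => f (z + t • v)) 0 = fderiv ℝ (fderiv ℝ f) z v v := by
  have hz : z + (0 : ℝ) • v = z := by simp
  rw [iteratedDeriv_succ, iteratedDeriv_one, deriv_deriv_comp_line (by rwa [hz]), hz]

theorem strictConvexOn_comp_line (hU : IsOpen U) (hUc : Convex ℝ U) (hf : ContDiffOn ℝ 2 f U)
    (hpos : ∀ z ∈ U, 0 < fderiv ℝ (fderiv ℝ f) z v v) :
    StrictConvexOn ℝ {t : ℝ | w + t • v ∈ U} fun t => f (w + t • v) := by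
  have hcd : ∀ {t : ℝ}, w + t • v ∈ U → ContDiffAt ℝ 2 f (w + t • v) := fun ht =>
    hf.contDiffAt (hU.mem_nhds ht)
  refine strictConvexOn_of_deriv2_pos'
    ((hUc.translate_preimage_right w).linear_preimage (LinearMap.toSpanSingleton ℝ E v))
    (fun t ht => ?_) fun t ht => ?_
  · exact (hasDerivAt_comp_line
      ((hcd ht).differentiableAt (by norm_num))).continuousAt.continuousWithinAt
  · exact (hpos _ ht).trans_eq (deriv_deriv_comp_line (hcd ht)).symm

theorem strictConcaveOn_comp_line (hU : IsOpen U) (hUc : Convex ℝ U) (hf : ContDiffOn ℝ 2 f U)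
    (hneg : ∀ z ∈ U, fderiv ℝ (fderiv ℝ f) z v v < 0) :
    StrictConcaveOn ℝ {t : ℝ | w + t • v ∈ U} fun t => f (w + t • v) := by
  have hfderiv : fderiv ℝ (fun z => -f z) = fun z => -fderiv ℝ f z := funext fun z => fderiv_fun_neg
  refine neg_strictConvexOn_iff.1 (strictConvexOn_comp_line (f := fun z => -f z) hU hUc hf.neg ?_)
  intro z hz
  rw [hfderiv, fderiv_fun_neg]
  exact neg_pos.2 (hneg z hz)

theorem pos_comp_line_of_hessian_pos (hU : IsOpen U) (hUc : Convex ℝ U) (hf : ContDiffOn ℝ 2 f U)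
    (hpos : ∀ z ∈ U, 0 < fderiv ℝ (fderiv ℝ f) z v v) (hz : z ∈ U) (hfz : f z = 0)
    (hfderiv : fderiv ℝ f z v = 0) {t : ℝ} (ht : z + t • v ∈ U) (ht0 : t ≠ 0) :
    0 < f (z + t • v) := by
  have hz0 : z + (0 : ℝ) • v = z := by simp
  have hdiff : DifferentiableAt ℝ f (z + (0 : ℝ) • v) := by
    rw [hz0]
    exact (hf.contDiffAt (hU.mem_nhds hz)).differentiableAt (by norm_num)
  have hderiv : HasDerivAt (fun t : ℝ => f (z + t • v)) 0 0 := by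
    simpa only [hz0, hfderiv] using hasDerivAt_comp_line hdiff
  exact pos_of_strictConvexOn_of_hasDerivAt_zero (strictConvexOn_comp_line hU hUc hf hpos)
    (by simpa using hz) (by simpa using hfz) hderiv ht ht0

end Lines

theorem laplacian_eq_sum_fderiv_fderiv (f : Plane → ℝ) (z : Plane) :
    Δ f z = ∑ k, fderiv ℝ (fderiv ℝ f) z (axisVec k) (axisVec k) := by
  simp [InnerProductSpace.laplacian_eq_iteratedFDeriv_orthonormalBasis f
    (EuclideanSpace.basisFun (Fin 2) ℝ), iteratedFDeriv_two_apply, axisVec]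

section Families

variable {E F G T : Type*} [NormedAddCommGroup E] [NormedSpace ℝ E] [NormedAddCommGroup F]
  [NormedSpace ℝ F] [NormedAddCommGroup G] [NormedSpace ℝ G] [TopologicalSpace T]

theorem contDiffOn_fderiv_left {m n : ℕ∞ω} {φ : E → F → G} {U : Set E} {Q : Set F} (hU : IsOpen U)
    (hφ : ContDiffOn ℝ n (fun p : E × F => φ p.1 p.2) (U ×ˢ Q)) (hmn : m + 1 ≤ n) :
    ContDiffOn ℝ m (fun p : E × F => fderiv ℝ (fun w => φ w p.2) p.1) (U ×ˢ Q) := by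
  have hwithin : ContDiffOn ℝ m (fun p : E × F => fderivWithin ℝ (fun w => φ w p.2) U p.1)
      (U ×ˢ Q) := fun p hp => by
    refine ContDiffWithinAt.fderivWithin (f := fun (p : E × F) (w : E) => φ w p.2) (g := Prod.fst)
      ?_ contDiffWithinAt_fst hU.uniqueDiffOn hmn hp fun _ h => h.1
    exact ContDiffWithinAt.comp (g := fun p : E × F => φ p.1 p.2)
      (f := fun r : (E × F) × E => (r.2, r.1.2)) (p, p.1) (hφ p hp)
      (by fun_prop) fun r hr => ⟨hr.2, hr.1.2⟩
  exact hwithin.congr fun p hp => (fderivWithin_of_isOpen hU hp.1).symm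

/-- A family of real functions, parametrised by a topological space, that is `C²` in the space
variable on `U`, the functions and their second derivatives being jointly continuous in the
parameter and the space variable. No differentiability in the parameter is required. -/
structure IsC2Family (f : T → E → ℝ) (U : Set E) : Prop where
  contDiffOn : ∀ q, ContDiffOn ℝ 2 (f q) U
  continuousOn : ContinuousOn (fun p : T × E => f p.1 p.2) (univ ×ˢ U)
  continuousOn_hessian :
    ContinuousOn (fun p : T × E => fderiv ℝ (fderiv ℝ (f p.1)) p.2) (univ ×ˢ U)

theorem fderiv_fderiv_const_smul (a : ℝ) (f : E → ℝ) :
    fderiv ℝ (fderiv ℝ (a • f)) = a • fderiv ℝ (fderiv ℝ f) := by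
  rw [fderiv_const_smul_field]
  exact fderiv_const_smul_field (f := fderiv ℝ f) a

namespace IsC2Family

variable {f : T → E → ℝ} {U V : Set E} {q₀ : T} {z₀ v : E}

theorem mono (hf : IsC2Family f U) (hVU : V ⊆ U) : IsC2Family f V where
  contDiffOn q := (hf.contDiffOn q).mono hVU
  continuousOn := hf.continuousOn.mono (prod_mono_right hVU)
  continuousOn_hessian := hf.continuousOn_hessian.mono (prod_mono_right hVU)

theorem const_smul (hf : IsC2Family f U) (a : ℝ) : IsC2Family (fun q => a • f q) U where
  contDiffOn q := (hf.contDiffOn q).const_smul a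
  continuousOn := hf.continuousOn.const_smul a
  continuousOn_hessian := by
    simp only [fderiv_fderiv_const_smul]
    exact hf.continuousOn_hessian.const_smul a

theorem of_contDiffOn {φ : E → F → ℝ} {Q : Set F} (hU : IsOpen U)
    (hφ : ContDiffOn ℝ 2 (fun p : E × F => φ p.1 p.2) (U ×ˢ Q)) :
    IsC2Family (fun (q : Q) z => φ z q) U where
  contDiffOn q := hφ.comp (f := fun z : E => (z, (q : F))) (by fun_prop) fun z hz => ⟨hz, q.2⟩
  continuousOn := hφ.continuousOn.comp (f := fun p : Q × E => (p.2, (p.1 : F))) (by fun_prop)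
    fun p hp => ⟨hp.2, p.1.2⟩
  continuousOn_hessian := by
    have hgrad := contDiffOn_fderiv_left (m := 1) hU hφ (by norm_num)
    have hhess := contDiffOn_fderiv_left (m := 0) (φ := fun z q => fderiv ℝ (fun w => φ w q) z) hU
      hgrad (by norm_num)
    exact hhess.continuousOn.comp (f := fun p : Q × E => (p.2, (p.1 : F))) (by fun_prop)
      fun p hp => ⟨hp.2, p.1.2⟩

theorem continuousAt_hessian_apply (hf : IsC2Family f U) (hU : U ∈ 𝓝 z₀) :
    ContinuousAt (fun p : T × E => fderiv ℝ (fderiv ℝ (f p.1)) p.2 v v) (q₀, z₀) := by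
  have hhess := hf.continuousOn_hessian.continuousAt
    (x := (q₀, z₀)) (prod_mem_nhds univ_mem hU)
  exact (hhess.clm_apply continuousAt_const).clm_apply continuousAt_const

end IsC2Family

end Families

theorem forall_fin_two_of_ne {i j : Fin 2} (hij : j ≠ i) {P : Fin 2 → Prop} :
    (∀ k, P k) ↔ P i ∧ P j := by
  refine ⟨fun h => ⟨h i, h j⟩, fun h k => ?_⟩
  obtain rfl | rfl : k = i ∨ k = j := by omega
  exacts [h.1, h.2]

theorem sum_fin_two_of_ne {M : Type*} [AddCommMonoid M] {i j : Fin 2} (hij : j ≠ i)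
    (f : Fin 2 → M) : ∑ k, f k = f i + f j := by
  rw [← Finset.sum_pair hij.symm]
  refine (Finset.sum_subset (Finset.subset_univ _) fun k _ hk => ?_).symm
  simp only [Finset.mem_insert, Finset.mem_singleton, not_or] at hk
  omega

/-- The point with inward normal coordinate `p.1` and tangential coordinate `p.2`, measured from
the point `z₀` of the side with outward normal `σ • axisVec i`. -/
noncomputable def sidePoint (i j : Fin 2) (σ : ℝ) (z₀ : Plane) (p : ℝ × ℝ) : Plane :=
  z₀ + p.1 • (-σ • axisVec i) + p.2 • axisVec j

section SidePoint

variable {i j : Fin 2} {σ : ℝ} {z₀ : Plane}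

theorem continuous_sidePoint : Continuous (sidePoint i j σ z₀) := by
  unfold sidePoint
  fun_prop

theorem sidePoint_zero : sidePoint i j σ z₀ (0, 0) = z₀ := by
  simp [sidePoint]

theorem sidePoint_apply_normal (hij : j ≠ i) (p : ℝ × ℝ) :
    sidePoint i j σ z₀ p i = z₀ i - σ * p.1 := by
  simp [sidePoint, axisVec, hij.symm]
  ring

theorem sidePoint_apply_tangent (hij : j ≠ i) (p : ℝ × ℝ) :
    sidePoint i j σ z₀ p j = z₀ j + p.2 := by
  simp [sidePoint, axisVec, hij]

/-- `sidePoint` as a homeomorphism; the inverse reads off the normal and tangential coordinates. -/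
noncomputable def sideHomeomorph (hij : j ≠ i) (hσ : σ * σ = 1) (z₀ : Plane) :
    ℝ × ℝ ≃ₜ Plane where
  toFun := sidePoint i j σ z₀
  invFun z := (σ * (z₀ i - z i), z j - z₀ j)
  left_inv p := by
    dsimp only
    rw [sidePoint_apply_normal hij, sidePoint_apply_tangent hij, sub_sub_cancel, ← mul_assoc, hσ,
      one_mul, add_sub_cancel_left]
  right_inv z := by
    ext k
    revert k
    rw [forall_fin_two_of_ne hij, sidePoint_apply_normal hij, sidePoint_apply_tangent hij,
      ← mul_assoc, hσ, one_mul]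
    exact ⟨sub_sub_cancel _ _, add_sub_cancel _ _⟩
  continuous_toFun := continuous_sidePoint
  continuous_invFun := by fun_prop

theorem sidePoint_mem_ball (hij : j ≠ i) (hσ : σ * σ = 1) {ε : ℝ} (hε : 0 < ε) {p : ℝ × ℝ} :
    sidePoint i j σ z₀ p ∈ Metric.ball z₀ ε ↔ p ∈ disc ε := by
  have hnormal : (σ * p.1) ^ 2 = p.1 ^ 2 := by rw [mul_pow, sq σ, hσ, one_mul]
  rw [Metric.mem_ball, EuclideanSpace.dist_eq, sum_fin_two_of_ne hij, Real.sqrt_lt' hε,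
    Real.dist_eq, Real.dist_eq, sq_abs, sq_abs, sidePoint_apply_normal hij,
    sidePoint_apply_tangent hij, sub_sub_cancel_left, add_sub_cancel_left, neg_sq, hnormal]
  rfl

end SidePoint

section Square

variable {i : Fin 2} {σ : ℝ} {z₀ z : Plane}

theorem eventually_forall_ne_mem_Ioo (hz₀ : z₀ ∈ openSide i σ) :
    ∀ᶠ z in 𝓝 z₀, ∀ k, k ≠ i → z k ∈ Ioo (-(π / 2)) (π / 2) := by
  simp only [eventually_all]
  exact fun k hk => (show Continuous fun z : Plane => z k by fun_prop).continuousAt.eventually_mem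
    (isOpen_Ioo.mem_nhds (hz₀.2 k hk))

theorem eventually_mem_openSide (hz₀ : z₀ ∈ openSide i σ) :
    ∀ᶠ z in 𝓝 z₀, z i = z₀ i → z ∈ openSide i σ := by
  filter_upwards [eventually_forall_ne_mem_Ioo hz₀] with z hz hzi
  exact ⟨hzi.trans hz₀.1, hz⟩

theorem eventually_mem_openSquare_iff (hσ : σ = 1 ∨ σ = -1) (hz₀ : z₀ ∈ openSide i σ) :
    ∀ᶠ z in 𝓝 z₀, (z ∈ openSquare ↔ 0 < σ * (z₀ i - z i)) := by
  have hopposite : ∀ᶠ z : Plane in 𝓝 z₀, σ * (z₀ i - z i) < π := by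
    have hcont : Continuous fun z : Plane => σ * (z₀ i - z i) := by fun_prop
    exact hcont.continuousAt.eventually_lt_const (by simpa using pi_pos)
  filter_upwards [eventually_forall_ne_mem_Ioo hz₀, hopposite] with z hz hzi
  have hnormal : z i ∈ Ioo (-(π / 2)) (π / 2) ↔ 0 < σ * (z₀ i - z i) := by
    rw [mem_Ioo]
    rw [hz₀.1] at hzi ⊢
    rcases hσ with rfl | rfl
    · exact ⟨fun h => by linarith [h.2], fun h => ⟨by linarith, by linarith⟩⟩
    · exact ⟨fun h => by linarith [h.1], fun h => ⟨by linarith, by linarith⟩⟩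
  refine ⟨fun h => hnormal.1 (h i), fun h k => ?_⟩
  rcases eq_or_ne k i with rfl | hk
  exacts [hnormal.2 h, hz k hk]

theorem add_smul_axisVec_mem_closedSquare (hσ : σ = 1 ∨ σ = -1) (hz : z ∈ openSide i σ) {t : ℝ}
    (ht : t ∈ Icc (-1) 0) : z + t • (σ • axisVec i) ∈ closedSquare := by
  have hpi := pi_gt_three
  intro k
  rcases eq_or_ne k i with rfl | hk
  · have hk : (z + t • (σ • axisVec k)) k = σ * (π / 2) + t * σ := by simp [axisVec, hz.1]
    rw [hk]
    rcases hσ with rfl | rfl <;> constructor <;> linarith [ht.1, ht.2]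
  · have hki : (z + t • (σ • axisVec i)) k = z k := by simp [axisVec, hk]
    exact hki ▸ Ioo_subset_Icc_self (hz.2 k hk)

namespace RobinCondition

variable {h : ℝ} {f : Plane → ℝ}

theorem hasDerivAt_inward (hf : RobinCondition h f) (hσ : σ = 1 ∨ σ = -1) (hz : z ∈ openSide i σ)
    (hd : DifferentiableAt ℝ f z) :
    HasDerivAt (fun t : ℝ => f (z + t • (-σ • axisVec i))) (h * f z) 0 := by
  have hz0 : ∀ v : Plane, z + (0 : ℝ) • v = z := fun v => by simp
  have huniq : UniqueDiffWithinAt ℝ {t : ℝ | z + t • (σ • axisVec i) ∈ closedSquare} 0 :=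
    ((uniqueDiffOn_Icc (by norm_num : (-1 : ℝ) < 0)) 0 (by simp)).mono fun _ ht =>
      add_smul_axisVec_mem_closedSquare hσ hz ht
  have houtward := hasDerivAt_comp_line (v := σ • axisVec i) (t := 0) ((hz0 _).symm ▸ hd)
  have hrobin : fderiv ℝ f z (σ • axisVec i) + h * f z = 0 := by
    have hline := houtward.hasDerivWithinAt.derivWithin huniq
    rw [hz0] at hline
    exact hline ▸ hf i σ hσ z hz
  convert hasDerivAt_comp_line (v := -σ • axisVec i) (t := 0) ((hz0 _).symm ▸ hd) using 1
  rw [hz0, neg_smul, map_neg]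
  linarith

theorem const_smul (hf : RobinCondition h f) (a : ℝ) : RobinCondition h (a • f) := by
  intro i σ hσ z hz
  have hderiv : lineDerivWithin ℝ (a • f) closedSquare z (σ • axisVec i) =
      a * lineDerivWithin ℝ f closedSquare z (σ • axisVec i) :=
    derivWithin_const_smul_field a fun t : ℝ => f (z + t • (σ • axisVec i))
  rw [hderiv, Pi.smul_apply, smul_eq_mul, mul_left_comm, ← mul_add, hf i σ hσ z hz, mul_zero]

end RobinCondition

end Square

theorem nodalDomains_const_smul {a : ℝ} (ha : a ≠ 0) (f : Plane → ℝ) (U : Set Plane) :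
    nodalDomains (a • f) U = nodalDomains f U := by
  simp only [nodalDomains, Pi.smul_apply, smul_ne_zero_iff_right ha]

section Restriction

variable {i j : Fin 2} {σ : ℝ} {z₀ : Plane} {ε : ℝ} {f : Plane → ℝ}

theorem encard_nodalDomains_ball_inter_openSquare (hij : j ≠ i) (hσ : σ * σ = 1) (hε : 0 < ε)
    (hsquare : ∀ z ∈ Metric.ball z₀ ε, (z ∈ openSquare ↔ 0 < σ * (z₀ i - z i))) :
    (nodalDomains f (Metric.ball z₀ ε ∩ openSquare)).encard =
      (componentsIn {p ∈ halfDisc ε | f (sidePoint i j σ z₀ p) ≠ 0}).encard := by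
  have himage : {z ∈ Metric.ball z₀ ε ∩ openSquare | f z ≠ 0} =
      sideHomeomorph hij hσ z₀ '' {p ∈ halfDisc ε | f (sidePoint i j σ z₀ p) ≠ 0} := by
    refine ((sideHomeomorph hij hσ z₀).toEquiv.preimage_eq_iff_eq_image _ _).1 ?_
    ext p
    have hball : sidePoint i j σ z₀ p ∈ Metric.ball z₀ ε ↔ p ∈ disc ε :=
      sidePoint_mem_ball hij hσ hε
    have hnormal : σ * (z₀ i - sidePoint i j σ z₀ p i) = p.1 := by
      rw [sidePoint_apply_normal hij, sub_sub_cancel, ← mul_assoc, hσ, one_mul]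
    refine and_congr_left fun _ => ?_
    change sidePoint i j σ z₀ p ∈ _ ∩ _ ↔ _
    rw [mem_inter_iff, and_congr_right fun hp => hsquare _ hp, hball, hnormal]
    rfl
  rw [nodalDomains_eq_componentsIn, himage, encard_componentsIn_image]

theorem isHalfDiscSaddle_comp_sidePoint (hij : j ≠ i) (hσ : σ = 1 ∨ σ = -1) (hε : 0 < ε)
    (hside : ∀ z ∈ Metric.ball z₀ ε, z i = z₀ i → z ∈ openSide i σ)
    (hf : ContDiffOn ℝ 2 f (Metric.ball z₀ ε)) {h : ℝ} (hh : 0 ≤ h) (hrobin : RobinCondition h f)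
    (hnormal : ∀ z ∈ Metric.ball z₀ ε, fderiv ℝ (fderiv ℝ f) z (axisVec i) (axisVec i) < 0)
    (htangent : ∀ z ∈ Metric.ball z₀ ε, 0 < fderiv ℝ (fderiv ℝ f) z (axisVec j) (axisVec j)) :
    IsHalfDiscSaddle ε (f ∘ sidePoint i j σ z₀) := by
  have hσσ : σ * σ = 1 := by rcases hσ with rfl | rfl <;> norm_num
  have hball : ∀ {p : ℝ × ℝ}, sidePoint i j σ z₀ p ∈ Metric.ball z₀ ε ↔ p ∈ disc ε :=
    sidePoint_mem_ball hij hσσ hε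
  have hopen : IsOpen (Metric.ball z₀ ε) := Metric.isOpen_ball
  have hconvex : Convex ℝ (Metric.ball z₀ ε) := convex_ball z₀ ε
  refine ⟨hf.continuousOn.comp continuous_sidePoint.continuousOn fun p => hball.2,
    fun {s x y} hx hxy hy hGx => ?_, fun x => ?_⟩
  · have hline : ∀ t : ℝ, sidePoint i j σ z₀ (t, s) =
        z₀ + s • axisVec j + t • (-σ • axisVec i) := fun t => add_right_comm _ _ _
    have hbase : z₀ + s • axisVec j = sidePoint i j σ z₀ (0, s) := by simp [sidePoint]
    have hbase_mem : z₀ + s • axisVec j ∈ Metric.ball z₀ ε := by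
      rw [hbase, hball]
      exact mem_disc_of_abs_le hy (by simp) le_rfl
    have hbase_side : z₀ + s • axisVec j ∈ openSide i σ :=
      hside _ hbase_mem (by simp [axisVec, hij.symm])
    have hconcave : StrictConcaveOn ℝ
        {t : ℝ | z₀ + s • axisVec j + t • (-σ • axisVec i) ∈ Metric.ball z₀ ε}
        fun t => f (z₀ + s • axisVec j + t • (-σ • axisVec i)) :=
      strictConcaveOn_comp_line hopen hconvex hf fun z hz => by
        simpa [← mul_assoc, hσσ] using hnormal z hz
    have hderiv := hrobin.hasDerivAt_inward hσ hbase_side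
      ((hf.contDiffAt (hopen.mem_nhds hbase_mem)).differentiableAt (by norm_num))
    rw [Function.comp_apply, hline] at hGx ⊢
    exact neg_of_strictConcaveOn_of_robin hconcave hh (by simpa using hderiv)
      (by simpa using hbase_mem)
      ((hline y).subst (motive := (· ∈ Metric.ball z₀ ε)) (hball.2 hy)) hx hxy hGx
  · have hslice : {s | (x, s) ∈ disc ε} =
        {s : ℝ | z₀ + x • (-σ • axisVec i) + s • axisVec j ∈ Metric.ball z₀ ε} :=
      Set.ext fun s => hball.symm
    rw [hslice]
    exact (strictConvexOn_comp_line hopen hconvex hf htangent).convexOn.quasiconvexOn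

end Restriction

section SmallBalls

variable {X T : Type*} [PseudoMetricSpace X] [TopologicalSpace T]

theorem eventually_forall_mem_ball {x : X} {P : X → Prop} (h : ∀ᶠ y in 𝓝 x, P y) :
    ∀ᶠ ε in 𝓝[>] (0 : ℝ), ∀ y ∈ Metric.ball x ε, P y :=
  nhdsWithin_le_nhds (eventually_ball_subset h)

theorem eventually_eventually_forall_mem_ball {t : T} {x : X} {P : T × X → Prop}
    (h : ∀ᶠ p in 𝓝 (t, x), P p) :
    ∀ᶠ ε in 𝓝[>] (0 : ℝ), ∀ᶠ q in 𝓝 t, ∀ y ∈ Metric.ball x ε, P (q, y) := by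
  have hball : Tendsto (Metric.ball x) (𝓝 0) (𝓝 x).smallSets :=
    tendsto_smallSets_iff.2 fun _ => eventually_ball_subset
  exact eventually_eventually_forall_mem (hball.mono_left nhdsWithin_le_nhds) h

theorem eventually_forall_dist_add_dist_le {Y : Type*} [PseudoMetricSpace Y]
    {Q : Set (X × Y)} {q₀ : Q} {P : X × Y → Prop} (h : ∀ᶠ q : Q in 𝓝 q₀, P q) :
    ∀ᶠ η in 𝓝[>] (0 : ℝ), ∀ q ∈ Q, dist q.1 q₀.1.1 + dist q.2 q₀.1.2 ≤ η → P q := by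
  rw [nhds_subtype_eq_comap, eventually_comap] at h
  filter_upwards [nhdsWithin_le_nhds (eventually_closedBall_subset h)] with η hη q hq hdist
  refine hη (Metric.mem_closedBall.2 ?_) ⟨q, hq⟩ rfl
  rw [Prod.dist_eq]
  exact (max_le_add_of_nonneg dist_nonneg dist_nonneg).trans hdist

end SmallBalls

section Saddle

variable {T : Type*} [TopologicalSpace T] {q₀ : T} {h : T → ℝ} {f : T → Plane → ℝ}
  {i j : Fin 2} {σ : ℝ} {z₀ : Plane} {U : Set Plane}

theorem eventually_encard_nodalDomains_of_saddle {ε : ℝ} (hij : j ≠ i) (hσ : σ * σ = 1)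
    (hε : 0 < ε)
    (hsquare : ∀ z ∈ Metric.ball z₀ ε, (z ∈ openSquare ↔ 0 < σ * (z₀ i - z i)))
    (hf : ContinuousOn (fun p : T × Plane => f p.1 p.2) (univ ×ˢ Metric.ball z₀ ε))
    (hsaddle : ∀ᶠ q in 𝓝 q₀, IsHalfDiscSaddle ε (f q ∘ sidePoint i j σ z₀))
    (hzero : f q₀ z₀ = 0)
    (hpos : ∀ s, (0, s) ∈ disc ε → s ≠ 0 → 0 < f q₀ (sidePoint i j σ z₀ (0, s))) :
    (nodalDomains (f q₀) (Metric.ball z₀ ε ∩ openSquare)).encard = 3 ∧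
      ∀ᶠ q in 𝓝 q₀, (nodalDomains (f q) (Metric.ball z₀ ε ∩ openSquare)).encard ≤ 3 := by
  simp only [encard_nodalDomains_ball_inter_openSquare (j := j) hij hσ hε hsquare]
  have hcont : ContinuousOn (Function.uncurry fun q => f q ∘ sidePoint i j σ z₀)
      (univ ×ˢ disc ε) :=
    hf.comp (f := Prod.map id (sidePoint i j σ z₀))
      (continuous_id.prodMap continuous_sidePoint).continuousOn
      fun p hp => ⟨mem_univ _, (sidePoint_mem_ball hij hσ hε).2 hp.2⟩
  have hzero' : (f q₀ ∘ sidePoint i j σ z₀) (0, 0) = 0 := by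
    rwa [Function.comp_apply, sidePoint_zero]
  have hmem : ∀ s, |s| ≤ ε / 2 → ((0 : ℝ), s) ∈ disc ε := fun s hs =>
    mem_disc_of_abs_le_half hε (by simpa using (half_pos hε).le) hs
  have hmem_left : ((0 : ℝ), -(ε / 2)) ∈ disc ε :=
    hmem _ (by rw [abs_neg, abs_of_pos (half_pos hε)])
  have hmem_right : ((0 : ℝ), ε / 2) ∈ disc ε := hmem _ (abs_of_pos (half_pos hε)).le
  have hneg : ∀ᶠ q in 𝓝 q₀, IsConnected (negRegion ε (f q ∘ sidePoint i j σ z₀)) := by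
    refine IsHalfDiscSaddle.eventually_isConnected_negRegion hε hsaddle hcont hzero'.le ?_
    intro a ha
    rw [hzero']
    exact hpos a (hmem a ha.le) (abs_pos.1 (ha ▸ half_pos hε))
  constructor
  · exact hsaddle.self_of_nhds.encard_componentsIn_eq_three hneg.self_of_nhds
      (hmem 0 (by simpa using (half_pos hε).le)) hzero'.le
      (neg_lt_zero.2 (half_pos hε)) (half_pos hε)
      hmem_left hmem_right (hpos _ hmem_left (neg_ne_zero.2 (half_pos hε).ne'))
      (hpos _ hmem_right (half_pos hε).ne')
  · filter_upwards [hsaddle, hneg] with q hq hqneg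
    exact hq.encard_componentsIn_le_three hqneg.isPreconnected

theorem eventually_encard_nodalDomains_of_hessian (hij : j ≠ i) (hσ : σ = 1 ∨ σ = -1)
    (hz₀ : z₀ ∈ openSide i σ) (hU : U ∈ 𝓝 z₀) (hf : IsC2Family f U) (hh : ∀ q, 0 ≤ h q)
    (hrobin : ∀ q, RobinCondition (h q) (f q)) (hzero : f q₀ z₀ = 0)
    (htan : fderiv ℝ (f q₀) z₀ (axisVec j) = 0)
    (hnormal : fderiv ℝ (fderiv ℝ (f q₀)) z₀ (axisVec i) (axisVec i) < 0)
    (htangent : 0 < fderiv ℝ (fderiv ℝ (f q₀)) z₀ (axisVec j) (axisVec j)) :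
    ∀ᶠ ε in 𝓝[>] (0 : ℝ),
      (nodalDomains (f q₀) (Metric.ball z₀ ε ∩ openSquare)).encard = 3 ∧
        ∀ᶠ q in 𝓝 q₀, (nodalDomains (f q) (Metric.ball z₀ ε ∩ openSquare)).encard ≤ 3 := by
  have hσσ : σ * σ = 1 := by rcases hσ with rfl | rfl <;> norm_num
  filter_upwards [eventually_forall_mem_ball hU,
    eventually_forall_mem_ball (eventually_mem_openSquare_iff hσ hz₀),
    eventually_forall_mem_ball (eventually_mem_openSide hz₀),
    eventually_eventually_forall_mem_ball
      ((hf.continuousAt_hessian_apply hU).eventually_lt_const hnormal),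
    eventually_eventually_forall_mem_ball
      ((hf.continuousAt_hessian_apply hU).eventually_const_lt htangent),
    self_mem_nhdsWithin] with ε hball hsquare hside hconcave hconvex hε
  have hfε : IsC2Family f (Metric.ball z₀ ε) := hf.mono hball
  have hpos : ∀ s, (0, s) ∈ disc ε → s ≠ 0 → 0 < f q₀ (sidePoint i j σ z₀ (0, s)) := by
    have hline : ∀ s : ℝ, sidePoint i j σ z₀ (0, s) = z₀ + s • axisVec j := fun s => by
      simp [sidePoint]
    intro s hs hs0
    rw [hline]
    exact pos_comp_line_of_hessian_pos Metric.isOpen_ball (convex_ball z₀ ε) (hfε.contDiffOn q₀)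
      hconvex.self_of_nhds (Metric.mem_ball_self hε) hzero htan
      (by rwa [← hline, sidePoint_mem_ball hij hσσ hε]) hs0
  refine eventually_encard_nodalDomains_of_saddle hij hσσ hε hsquare hfε.continuousOn ?_ hzero hpos
  filter_upwards [hconcave, hconvex] with q hconcave hconvex
  exact isHalfDiscSaddle_comp_sidePoint hij hσ hε hside (hfε.contDiffOn q) (hh q) (hrobin q)
    hconcave hconvex

theorem mainTheorem5_general (hij : j ≠ i) (hσ : σ = 1 ∨ σ = -1) (hz₀ : z₀ ∈ openSide i σ)
    (hU : U ∈ 𝓝 z₀) (hf : IsC2Family f U) (hh : ∀ q, 0 ≤ h q)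
    (hrobin : ∀ q, RobinCondition (h q) (f q)) (hzero : f q₀ z₀ = 0)
    (hlap : Δ (f q₀) z₀ = 0) (htan : deriv (fun t : ℝ => f q₀ (z₀ + t • axisVec j)) 0 = 0)
    (htan2 : iteratedDeriv 2 (fun t : ℝ => f q₀ (z₀ + t • axisVec j)) 0 ≠ 0) :
    ∀ᶠ ε in 𝓝[>] (0 : ℝ),
      (nodalDomains (f q₀) (Metric.ball z₀ ε ∩ openSquare)).encard = 3 ∧
        ∀ᶠ q in 𝓝 q₀, (nodalDomains (f q) (Metric.ball z₀ ε ∩ openSquare)).encard ≤ 3 := by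
  set a : ℝ := fderiv ℝ (fderiv ℝ (f q₀)) z₀ (axisVec j) (axisVec j) with ha
  have hC2 : ContDiffAt ℝ 2 (f q₀) z₀ := (hf.contDiffOn q₀).contDiffAt hU
  have ha0 : a ≠ 0 := by rwa [iteratedDeriv_two_comp_line hC2] at htan2
  have hnormal : fderiv ℝ (fderiv ℝ (f q₀)) z₀ (axisVec i) (axisVec i) = -a := by
    rw [laplacian_eq_sum_fderiv_fderiv, sum_fin_two_of_ne hij] at hlap
    exact eq_neg_of_add_eq_zero_left hlap
  have hslope : fderiv ℝ (f q₀) z₀ (axisVec j) = 0 := by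
    have hline : z₀ + (0 : ℝ) • axisVec j = z₀ := by simp
    rwa [(hasDerivAt_comp_line (hline.symm ▸ hC2.differentiableAt (by norm_num))).deriv,
      hline] at htan
  simp only [← nodalDomains_const_smul ha0 (f _)]
  refine eventually_encard_nodalDomains_of_hessian hij hσ hz₀ hU (hf.const_smul a) hh
    (fun q => (hrobin q).const_smul a) (by simp [hzero]) ?_ ?_ ?_
  · rw [fderiv_const_smul_field]
    simp [hslope]
  · rw [fderiv_fderiv_const_smul]
    simpa [hnormal] using ha0
  · rw [fderiv_fderiv_const_smul]
    simpa [← ha] using ha0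

end Saddle

theorem mainTheorem5
    (Θ : Set ℝ) (hΘ : IsOpen Θ) (h₀ : ℝ) (hh₀ : 0 < h₀) (ev : ℝ → ℝ)
    (Φ : Plane → ℝ → ℝ → ℝ)
    -- a smooth family of Robin eigenfunctions on the square
    (hΦ : IsSmoothRobinFamily Θ h₀ ev Φ)
    -- a non-corner point on one side; `i` is the normal and `j` the tangential coordinate
    (i j : Fin 2) (hij : j ≠ i) (σ : ℝ) (hσ : σ = 1 ∨ σ = -1)
    (z₀ : Plane) (hz₀ : z₀ ∈ openSide i σ)
    (θ₀ : ℝ) (hθ₀ : θ₀ ∈ Θ)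
    -- conditions at `z₀` for the parameters `(θ₀, 0)`
    (hzero : Φ z₀ θ₀ 0 = 0)
    (htan : deriv (fun t : ℝ => Φ (z₀ + t • axisVec j) θ₀ 0) 0 = 0)
    (htan2 : iteratedDeriv 2 (fun t : ℝ => Φ (z₀ + t • axisVec j) θ₀ 0) 0 ≠ 0)
    (hpar : deriv (fun θ : ℝ => Φ z₀ θ 0) θ₀ ≠ 0)
    -- near `z₀` the family is smooth and solves the equation on a full disc of the plane
    (ε₁ : ℝ) (hε₁ : 0 < ε₁) (η₁ : ℝ) (hη₁ : 0 < η₁)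
    (hsmooth : ContDiffOn ℝ ∞ (fun p : Plane × ℝ × ℝ => Φ p.1 p.2.1 p.2.2)
      (Metric.ball z₀ ε₁ ×ˢ {q : ℝ × ℝ | q.1 ∈ Θ ∧ q.2 ∈ Ico 0 h₀ ∧ |q.1 - θ₀| + q.2 ≤ η₁}))
    (heq : ∀ θ ∈ Θ, ∀ h ∈ Ico 0 h₀, |θ - θ₀| + h ≤ η₁ → ∀ z ∈ Metric.ball z₀ ε₁,
      -(Δ (fun w => Φ w θ h) z) = ev h * Φ z θ h) :
    ∃ ε₀ : ℝ, 0 < ε₀ ∧ ε₀ < ε₁ ∧ ∃ η₀ : ℝ, 0 < η₀ ∧ η₀ < η₁ ∧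
      (nodalDomains (fun z => Φ z θ₀ 0) (Metric.ball z₀ ε₀ ∩ openSquare)).encard = 3 ∧
      ∀ θ ∈ Θ, ∀ h ∈ Ico 0 h₀, |θ - θ₀| + h ≤ η₀ →
        (nodalDomains (fun z => Φ z θ h) (Metric.ball z₀ ε₀ ∩ openSquare)).encard ≤ 3 := by
  set Q : Set (ℝ × ℝ) := {q | q.1 ∈ Θ ∧ q.2 ∈ Ico 0 h₀ ∧ |q.1 - θ₀| + q.2 ≤ η₁}
  have hq₀ : (θ₀, (0 : ℝ)) ∈ Q := ⟨hθ₀, ⟨le_rfl, hh₀⟩, by simpa using hη₁.le⟩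
  have hfamily : IsC2Family (fun (q : Q) z => Φ z q.1.1 q.1.2) (Metric.ball z₀ ε₁) :=
    .of_contDiffOn (φ := fun z (q : ℝ × ℝ) => Φ z q.1 q.2) Metric.isOpen_ball
      (hsmooth.of_le ENat.LEInfty.out)
  have hlap : Δ (fun z => Φ z θ₀ 0) z₀ = 0 := by
    simpa [hzero] using heq θ₀ hθ₀ 0 ⟨le_rfl, hh₀⟩ hq₀.2.2 z₀ (Metric.mem_ball_self hε₁)
  have hnonneg : ∀ q : Q, 0 ≤ q.1.2 := fun q => q.2.2.1.1
  have hrobin : ∀ q : Q, RobinCondition q.1.2 fun z => Φ z q.1.1 q.1.2 := fun q =>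
    (hΦ.eigenfunction _ q.2.1 _ q.2.2.1).robin
  have hcount := mainTheorem5_general (q₀ := (⟨(θ₀, 0), hq₀⟩ : Q)) hij hσ hz₀
    (Metric.ball_mem_nhds z₀ hε₁) hfamily hnonneg hrobin hzero hlap htan htan2
  obtain ⟨ε₀, ⟨hthree, hle⟩, hε₀⟩ := (hcount.and (Ioo_mem_nhdsGT hε₁)).exists
  obtain ⟨η₀, hη₀_le, hη₀⟩ :=
    ((eventually_forall_dist_add_dist_le (P := fun q =>
      (nodalDomains (fun z => Φ z q.1 q.2) (Metric.ball z₀ ε₀ ∩ openSquare)).encard ≤ 3) hle).and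
      (Ioo_mem_nhdsGT hη₁)).exists
  refine ⟨ε₀, hε₀.1, hε₀.2, η₀, hη₀.1, hη₀.2, hthree, fun θ hθ h hh hθh => ?_⟩
  refine hη₀_le (θ, h) ⟨hθ, hh, hθh.trans hη₀.2.le⟩ ?_
  simpa [Real.dist_eq, abs_of_nonneg hh.1] using hθh
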